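/- Let $m\ge 2$ and $n\ge 1$ be integers, let $\Omega\subset\mathbb{R}^m$ be open, and let $f=(f^1,\dots,f^{2n+1})\in W^{1,1}_{\mathrm{loc}}(\Omega,\mathbb{R}^{2n+1})$; that is, $f$ is locally integrable on $\Omega$ and has a locally integrable weak differential on $\Omega$. Let $df^i$ denote the weak differential of $f^i$, viewed as a one-form with locally integrable coefficients. If the contact equation $$df^{2n+1}=\sum_{j=1}^n\bigl(f^j\,df^{j+n}-f^{j+n}\,df^j\bigr)$$ holds almost everywhere in $\Omega$, then $$\sum_{j=1}^n df^j\wedge df^{j+n}=0\qquad\text{almost everywhere in }\Omega,$$ where $\wedge$ denotes the pointwise wedge product of the covectors $df^j(x)$ and $df^{j+n}(x)$. -/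

import Mathlib

open MeasureTheory Set
open scoped ContDiff

noncomputable section

/-- `f'` is a weak (distributional) differential of `f` on the open set `Ω`: it is locally
integrable on `Ω` and `∫_Ω ∂ᵥφ • f = - ∫_Ω φ • (f' v)` for every smooth real-valued test function
`φ` with compact support contained in `Ω` and every direction `v`. -/
structure IsWeakFDeriv {m : ℕ} {F : Type*} [NormedAddCommGroup F] [NormedSpace ℝ F]
    (Ω : Set (EuclideanSpace ℝ (Fin m))) (f : EuclideanSpace ℝ (Fin m) → F)
    (f' : EuclideanSpace ℝ (Fin m) → EuclideanSpace ℝ (Fin m) →L[ℝ] F) : Prop where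
  locallyIntegrableOn : LocallyIntegrableOn f' Ω volume
  integral_eq : ∀ φ : EuclideanSpace ℝ (Fin m) → ℝ,
    ContDiff ℝ ∞ φ → HasCompactSupport φ → tsupport φ ⊆ Ω →
    ∀ v : EuclideanSpace ℝ (Fin m),
      ∫ x in Ω, (fderiv ℝ φ x v) • f x = - ∫ x in Ω, φ x • f' x v

/-- `f ∈ W^{1,1}_loc(Ω, F)`: `f` is locally integrable on `Ω` and has a (locally integrable) weak
differential on `Ω`. -/
def MemW11Loc {m : ℕ} {F : Type*} [NormedAddCommGroup F] [NormedSpace ℝ F]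
    (Ω : Set (EuclideanSpace ℝ (Fin m))) (f : EuclideanSpace ℝ (Fin m) → F) : Prop :=
  LocallyIntegrableOn f Ω volume ∧ ∃ f', IsWeakFDeriv Ω f f'

/-- The wedge product `α ∧ β` of two covectors, as an alternating 2-form: the alternatization of
`(v, w) ↦ α v * β w`. -/
def covectorWedge {E : Type*} [NormedAddCommGroup E] [NormedSpace ℝ E]
    (α β : E →L[ℝ] ℝ) : E [⋀^Fin 2]→L[ℝ] ℝ :=
  ContinuousMultilinearMap.alternatization
    ((ContinuousMultilinearMap.mkPiAlgebra ℝ (Fin 2) ℝ).compContinuousLinearMap ![α, β])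

theorem covectorWedge_apply {E : Type*} [NormedAddCommGroup E] [NormedSpace ℝ E]
    (α β : E →L[ℝ] ℝ) (v : Fin 2 → E) :
    covectorWedge α β v = α (v 0) * β (v 1) - α (v 1) * β (v 0) := by
  have h : (Finset.univ : Finset (Equiv.Perm (Fin 2))) = {1, Equiv.swap 0 1} := by decide
  rw [covectorWedge, ContinuousMultilinearMap.alternatization_apply_apply, h,
    Finset.sum_pair (by decide)]
  simp [Fin.prod_univ_two, sub_eq_add_neg]

/-- The 0-based position `j` of the coordinate `x_{j+1}`, `0 ≤ j < n`, of `ℝ^{2n+1}`. -/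
def idxFst {n : ℕ} (j : Fin n) : Fin (2 * n + 1) := ⟨j, by omega⟩

/-- The 0-based position `n + j` of the coordinate `x_{n+j+1}`, `0 ≤ j < n`, of `ℝ^{2n+1}`. -/
def idxSnd {n : ℕ} (j : Fin n) : Fin (2 * n + 1) := ⟨n + j, by omega⟩

/-- The 0-based position `2n` of the last (vertical) coordinate `x_{2n+1}` of `ℝ^{2n+1}`. -/
def idxLast (n : ℕ) : Fin (2 * n + 1) := Fin.last (2 * n)

/-- The `i`-th component `df^i` of the differential of a map with values in `ℝ^k`. -/
def diffComp {m k : ℕ}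
    (A : EuclideanSpace ℝ (Fin m) →L[ℝ] EuclideanSpace ℝ (Fin k)) (i : Fin k) :
    EuclideanSpace ℝ (Fin m) →L[ℝ] ℝ :=
  (EuclideanSpace.proj i).comp A

/-- The contact equation `A^{2n+1} = ∑ⱼ (pʲ A^{j+n} - p^{j+n} A^j)`, at a point where the
map has value `p` and differential `A`. -/
def ContactEq {m n : ℕ} (p : EuclideanSpace ℝ (Fin (2 * n + 1)))
    (A : EuclideanSpace ℝ (Fin m) →L[ℝ] EuclideanSpace ℝ (Fin (2 * n + 1))) : Prop :=
  diffComp A (idxLast n) =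
    ∑ j : Fin n, (p (idxFst j) • diffComp A (idxSnd j) - p (idxSnd j) • diffComp A (idxFst j))

end

/-! Formally one applies `d` to the contact equation, but for Sobolev exponent one the products
`df^j ∧ df^{j+n}` need not be locally integrable, so the product rule is not available. The proof
instead measures how the image of a small parallelogram closes up.

Write the equation as `lam (df) = B f df` with `B` alternating. Let `x₀` be a Lebesgue point of the
directional derivatives along `v` and `w`, with values `a` and `b` there. For almost every `x`, the
increments of `f` along the edges of the parallelogram at `x` with sides `h • v`, `h • w` are
integrals of the weak derivatives (`HasWeakDirDeriv.ae_translate_sub`). Averaging over `x` in a ball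
of radius `h` finds an `x` whose four edges have total velocity deviation at most `h * η`
(`abs_bilin_le_of_average_le`). On each edge the contact equation then gives the `lam`-increment as
`B` of the initial vertex and the increment, up to `O(h² η)` (`abs_contact_segment_le`). Around the
loop the `lam`-increments cancel, while the `B`-terms sum to `2 h² B a b + O(h² η)`
(`abs_bilin_le_of_quadrilateral`). Dividing by `h²` and letting `η → 0` gives `B a b = 0`. -/

/-- `g` is a weak derivative of `f` on `U` in the direction `v`, for functions defined on the whole
space. -/
def HasWeakDirDeriv {E F : Type*} [NormedAddCommGroup E] [NormedSpace ℝ E] [MeasurableSpace E]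
    [NormedAddCommGroup F] [NormedSpace ℝ F]
    (μ : Measure E) (U : Set E) (v : E) (f g : E → F) : Prop :=
  ∀ φ : E → ℝ, ContDiff ℝ ∞ φ → HasCompactSupport φ → tsupport φ ⊆ U →
    ∫ x, (fderiv ℝ φ x v) • f x ∂μ = - ∫ x, φ x • g x ∂μ

/-! ### Weak derivatives as difference quotients along translates -/

section Translation

variable {E F : Type*} [NormedAddCommGroup E] [NormedSpace ℝ E] [FiniteDimensional ℝ E]
  [MeasurableSpace E] [BorelSpace E] {μ : Measure E} [μ.IsAddHaarMeasure]
  [NormedAddCommGroup F] {f g : E → F} {U W : Set E} {v : E}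

theorem integrable_translate_prod (hgi : Integrable g μ) (hgm : StronglyMeasurable g)
    (c v : E) (t : ℝ) :
    Integrable (fun p : E × ℝ => g (p.1 + c + p.2 • v))
      (μ.prod (volume.restrict (Ioc 0 t))) := by
  have hm : StronglyMeasurable (fun p : E × ℝ => g (p.1 + c + p.2 • v)) :=
    hgm.comp_measurable (by fun_prop)
  rw [integrable_prod_iff' hm.aestronglyMeasurable]
  refine ⟨Filter.Eventually.of_forall fun s => ?_, ?_⟩
  · simpa [add_assoc] using hgi.comp_add_right (c + s • v)
  · have : (fun s : ℝ => ∫ x, ‖g (x + c + s • v)‖ ∂μ) = fun _ => ∫ x, ‖g x‖ ∂μ := by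
      funext s
      simpa [add_assoc] using integral_add_right_eq_self (μ := μ) (fun x => ‖g x‖) (c + s • v)
    simp only [this]
    exact integrable_const _

theorem ae_intervalIntegrable_translate (hgi : Integrable g μ) (hgm : StronglyMeasurable g)
    {t : ℝ} (ht : 0 ≤ t) :
    ∀ᵐ x ∂μ, IntervalIntegrable (fun s => g (x + s • v)) volume 0 t := by
  have := (integrable_translate_prod hgi hgm 0 v t).prod_right_ae
  filter_upwards [this] with x hx
  rw [intervalIntegrable_iff_integrableOn_Ioc_of_le ht]
  simpa [IntegrableOn] using hx

variable [NormedSpace ℝ F] [CompleteSpace F]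

/-- By duality: moving the translation onto the test function turns the claim into the classical
fundamental theorem for `φ`, Fubini, and the weak derivative tested against translates of `φ`. -/
theorem HasWeakDirDeriv.ae_translate_sub (hw : HasWeakDirDeriv μ U v f g)
    (hfi : Integrable f μ)
    (hgi : Integrable g μ) (hgm : StronglyMeasurable g) (hW : IsOpen W) {t : ℝ} (ht : 0 ≤ t)
    (hWU : ∀ x ∈ W, ∀ s ∈ Icc 0 t, x + s • v ∈ U) :
    ∀ᵐ x ∂μ, x ∈ W → f (x + t • v) = f x + ∫ s in (0 : ℝ)..t, g (x + s • v) := by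
  have hprod := integrable_translate_prod (μ := μ) hgi hgm 0 v t
  have hI : Integrable (fun x => ∫ s in Ioc 0 t, g (x + s • v)) μ := by
    simpa using hprod.integral_prod_left
  have hft : Integrable (fun x => f (x + t • v)) μ := hfi.comp_add_right (t • v)
  have key : ∀ᵐ x ∂μ, x ∈ W →
      f (x + t • v) - f x - ∫ s in Ioc 0 t, g (x + s • v) = 0 := by
    refine hW.ae_eq_zero_of_integral_contDiff_smul_eq_zero
      (((hft.sub hfi).sub hI).locallyIntegrable.locallyIntegrableOn _) ?_
    intro φ hφ hφc hφW
    have hφcont : Continuous φ := hφ.continuous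
    obtain ⟨C, hC⟩ := hφcont.bounded_above_of_compact_support hφc
    have hdcont : Continuous (fun x => fderiv ℝ φ x v) :=
      (hφ.continuous_fderiv (by simp)).clm_apply continuous_const
    have hdc : HasCompactSupport (fun x => fderiv ℝ φ x v) := hφc.fderiv_apply ℝ v
    obtain ⟨C', hC'⟩ := hdcont.bounded_above_of_compact_support hdc
    have i1 : Integrable (fun x => φ x • f (x + t • v)) μ :=
      hft.bdd_smul C hφcont.aestronglyMeasurable (Filter.Eventually.of_forall hC)
    have i2 : Integrable (fun x => φ x • f x) μ :=
      hfi.bdd_smul C hφcont.aestronglyMeasurable (Filter.Eventually.of_forall hC)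
    have i3 : Integrable (fun x => φ x • ∫ s in Ioc 0 t, g (x + s • v)) μ :=
      hI.bdd_smul C hφcont.aestronglyMeasurable (Filter.Eventually.of_forall hC)
    have i4 : Integrable (fun x => φ (x - t • v) • f x) μ :=
      hfi.bdd_smul C (by fun_prop) (Filter.Eventually.of_forall fun x => hC _)
    -- both sides are integrated against the translates of `φ`
    have e1 : ∫ x, φ x • f (x + t • v) ∂μ = ∫ x, φ (x - t • v) • f x ∂μ := by
      rw [← integral_sub_right_eq_self (fun x => φ x • f (x + t • v)) (t • v)]
      simp
    have e2 : ∀ x, φ (x - t • v) - φ x = - ∫ s in (0 : ℝ)..t, fderiv ℝ φ (x - s • v) v := by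
      intro x
      have hd : ∀ s ∈ uIcc 0 t, HasDerivAt (fun s : ℝ => φ (x - s • v))
          (- fderiv ℝ φ (x - s • v) v) s := by
        intro s _
        have h1 : HasDerivAt (fun s : ℝ => x - s • v) (-v) s := by
          simpa using ((hasDerivAt_id s).smul_const v).const_sub x
        have h2 := ((hφ.differentiable (by simp)) (x - s • v)).hasFDerivAt
        simpa [Function.comp_def] using h2.comp_hasDerivAt s h1
      have hc : Continuous (fun s : ℝ => - fderiv ℝ φ (x - s • v) v) :=
        (hdcont.comp (g := fun x => fderiv ℝ φ x v) (f := fun s : ℝ => x - s • v)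
          (by fun_prop)).neg
      have := intervalIntegral.integral_eq_sub_of_hasDerivAt hd (hc.intervalIntegrable _ _)
      rw [intervalIntegral.integral_neg] at this
      simpa using this.symm
    have e3 : ∀ s ∈ Ioc 0 t, ∫ x, (fderiv ℝ φ (x - s • v) v) • f x ∂μ
        = - ∫ x, φ (x - s • v) • g x ∂μ := by
      intro s hs
      -- The translated test function is admissible because the whole segment from each point of `W`
      -- stays in `U`.
      have hsupp : tsupport (fun x => φ (x - s • v)) ⊆ U := by
        intro x hx
        have hx' : x - s • v ∈ tsupport φ :=
          tsupport_comp_subset_preimage φ (f := fun x => x - s • v) (by fun_prop) hx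
        simpa using hWU _ (hφW hx') s ⟨hs.1.le, hs.2⟩
      have := hw (fun x => φ (x - s • v)) (hφ.comp (by fun_prop))
        (by simpa [sub_eq_add_neg, Function.comp_def] using
          hφc.comp_homeomorph (Homeomorph.addRight (-(s • v)))) hsupp
      have hd : ∀ x, fderiv ℝ (fun x => φ (x - s • v)) x = fderiv ℝ φ (x - s • v) := fun x => by
        simpa only [sub_eq_add_neg] using fderiv_comp_add_right (𝕜 := ℝ) (f := φ) (x := x) (-(s • v))
      simpa only [hd] using this
    have e4 : ∀ s : ℝ, ∫ x, φ (x - s • v) • g x ∂μ = ∫ x, φ x • g (x + s • v) ∂μ := by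
      intro s
      rw [← integral_sub_right_eq_self (fun x => φ x • g (x + s • v)) (s • v)]
      simp
    have j1 : Integrable (fun p : E × ℝ => (fderiv ℝ φ (p.1 - p.2 • v) v) • f p.1)
        (μ.prod (volume.restrict (Ioc 0 t))) := by
      refine (hfi.comp_fst (volume.restrict (Ioc 0 t))).bdd_smul C' ?_
        (Filter.Eventually.of_forall fun p => hC' _)
      exact (hdcont.comp (g := fun x => fderiv ℝ φ x v) (f := fun p : E × ℝ => p.1 - p.2 • v)
          (by fun_prop)).aestronglyMeasurable
    have j2 : Integrable (fun p : E × ℝ => φ p.1 • g (p.1 + p.2 • v))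
        (μ.prod (volume.restrict (Ioc 0 t))) := by
      refine Integrable.bdd_smul (φ := fun p : E × ℝ => φ p.1) (f := fun p : E × ℝ => g (p.1 + p.2 • v))
        (by simpa using hprod) C (by fun_prop) (Filter.Eventually.of_forall fun p => hC _)
    have e5 : ∫ x, φ (x - t • v) • f x ∂μ - ∫ x, φ x • f x ∂μ
        = ∫ x, φ x • (∫ s in Ioc 0 t, g (x + s • v)) ∂μ := by
      calc _ = ∫ x, (φ (x - t • v) - φ x) • f x ∂μ := by
            rw [← integral_sub i4 i2]; simp only [sub_smul]
        _ = - ∫ x, (∫ s in Ioc 0 t, (fderiv ℝ φ (x - s • v) v) • f x) ∂μ := by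
            rw [← integral_neg]
            congr 1 with x
            rw [e2, neg_smul, ← intervalIntegral.integral_smul_const,
              intervalIntegral.integral_of_le ht]
        _ = - ∫ s in Ioc 0 t, ∫ x, (fderiv ℝ φ (x - s • v) v) • f x ∂μ := by
            rw [integral_integral_swap j1]
        _ = ∫ s in Ioc 0 t, ∫ x, φ x • g (x + s • v) ∂μ := by
            rw [← integral_neg]
            refine setIntegral_congr_fun measurableSet_Ioc fun s hs => ?_
            simp only [e3 s hs, e4, neg_neg]
        _ = ∫ x, (∫ s in Ioc 0 t, φ x • g (x + s • v)) ∂μ := by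
            rw [← integral_integral_swap j2]
        _ = _ := by simp only [integral_smul]
    simp only [smul_sub]
    have hsplit := integral_sub (i1.sub i2) i3
    simp only [Pi.sub_apply] at hsplit
    rw [hsplit, integral_sub i1 i2, e1, e5, sub_self]
  filter_upwards [key] with x hx hxW
  rw [intervalIntegral.integral_of_le ht]
  have := hx hxW
  rw [sub_eq_zero] at this
  rw [← this]; abel

end Translation

/-! ### One-dimensional and bilinear estimates -/

section Segment

variable {F : Type*} [NormedAddCommGroup F] [NormedSpace ℝ F]
  {B : F →L[ℝ] F →L[ℝ] ℝ} {lam : F →L[ℝ] ℝ}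

theorem norm_integral_sub_smul_le [CompleteSpace F] {g : ℝ → F} {h : ℝ} (hh : 0 ≤ h)
    (hg : IntervalIntegrable g volume 0 h) (a : F) :
    ‖(∫ s in (0 : ℝ)..h, g s) - h • a‖ ≤ ∫ s in (0 : ℝ)..h, ‖g s - a‖ := by
  have : (∫ s in (0 : ℝ)..h, g s) - h • a = ∫ s in (0 : ℝ)..h, (g s - a) := by
    rw [intervalIntegral.integral_sub hg intervalIntegrable_const]
    simp
  rw [this]
  exact intervalIntegral.norm_integral_le_integral_norm hh

/-- Along a curve with velocity close to the constant `a` which satisfies the contact equation, the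
increment of the vertical coordinate is nearly that of the segment joining the end points. -/
theorem abs_contact_segment_le [CompleteSpace F] {g : ℝ → F} {h : ℝ} (hh : 0 ≤ h)
    (hB : ∀ x, B x x = 0) (hg : IntervalIntegrable g volume 0 h) (p a : F)
    (hc : ∀ᵐ t ∂(volume.restrict (Ioc 0 h)),
      lam (g t) = B (p + ∫ s in (0 : ℝ)..t, g s) (g t)) :
    |lam (∫ s in (0 : ℝ)..h, g s) - B p (∫ s in (0 : ℝ)..h, g s)|
      ≤ ‖B‖ * (2 * h * ‖a‖ * (∫ s in (0 : ℝ)..h, ‖g s - a‖)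
          + (∫ s in (0 : ℝ)..h, ‖g s - a‖) ^ 2) := by
  set e := ∫ s in (0 : ℝ)..h, ‖g s - a‖ with he
  have hga : IntervalIntegrable (fun s => ‖g s - a‖) volume 0 h :=
    (hg.sub intervalIntegrable_const).norm
  have h1 : lam (∫ s in (0 : ℝ)..h, g s) - B p (∫ s in (0 : ℝ)..h, g s)
      = ∫ t in (0 : ℝ)..h, (lam - B p) (g t) := by
    rw [ContinuousLinearMap.intervalIntegral_comp_comm _ hg]
    simp
  have h2 : ∀ᵐ t, t ∈ Ioc 0 h → ‖(lam - B p) (g t)‖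
      ≤ ‖B‖ * (h * ‖a‖ + e) * ‖g t - a‖ + ‖B‖ * e * ‖a‖ := by
    filter_upwards [(ae_restrict_iff' measurableSet_Ioc).1 hc] with t ht htm
    have hgt : IntervalIntegrable g volume 0 t :=
      hg.mono_set (by rw [uIcc_of_le hh, uIcc_of_le htm.1.le]; exact Icc_subset_Icc_right htm.2)
    set d := (∫ s in (0 : ℝ)..t, g s) - t • a with hd
    have hde : ‖d‖ ≤ e := (norm_integral_sub_smul_le htm.1.le hgt a).trans <|
      intervalIntegral.integral_mono_interval le_rfl htm.1.le htm.2
        (Filter.Eventually.of_forall fun _ => norm_nonneg _) hga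
    have hI : (∫ s in (0 : ℝ)..t, g s) = t • a + d := by rw [hd]; abel
    -- The main term `t * B a a` vanishes, so every remaining term carries a deviation factor.
    have hexp : (lam - B p) (g t) = t * B a (g t - a) + B d (g t - a) + B d a := by
      rw [sub_apply, ht htm, hI]
      simp only [map_add, map_sub, map_smul, add_apply, smul_apply, hB, smul_eq_mul]
      ring
    have b1 : ‖B a (g t - a)‖ ≤ ‖B‖ * ‖a‖ * ‖g t - a‖ := B.le_opNorm₂ _ _
    have b2 : ‖B d (g t - a)‖ ≤ ‖B‖ * e * ‖g t - a‖ :=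
      (B.le_opNorm₂ _ _).trans (by gcongr)
    have b3 : ‖B d a‖ ≤ ‖B‖ * e * ‖a‖ := (B.le_opNorm₂ _ _).trans (by gcongr)
    have b4 : ‖t * B a (g t - a)‖ ≤ h * (‖B‖ * ‖a‖ * ‖g t - a‖) := by
      rw [norm_mul, Real.norm_of_nonneg htm.1.le]
      have := htm.2
      gcongr
    rw [hexp]
    calc _ ≤ ‖t * B a (g t - a)‖ + ‖B d (g t - a)‖ + ‖B d a‖ := norm_add₃_le
      _ ≤ h * (‖B‖ * ‖a‖ * ‖g t - a‖) + ‖B‖ * e * ‖g t - a‖ + ‖B‖ * e * ‖a‖ := by gcongr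
      _ = _ := by ring
  rw [h1, ← Real.norm_eq_abs]
  refine (intervalIntegral.norm_integral_le_of_norm_le hh h2
    ((hga.const_mul _).add intervalIntegrable_const)).trans (le_of_eq ?_)
  rw [intervalIntegral.integral_add (hga.const_mul _) intervalIntegrable_const,
    intervalIntegral.integral_const_mul, ← he, intervalIntegral.integral_const, smul_eq_mul]
  ring

theorem abs_bilin_sub_le {d₁ d₂ a b : F} {h e : ℝ} (hh : 0 ≤ h)
    (h₁ : ‖d₁ - h • a‖ ≤ e) (h₂ : ‖d₂ - h • b‖ ≤ e) :
    |B d₁ d₂ - h ^ 2 * B a b| ≤ ‖B‖ * (h * ‖a‖ * e + h * ‖b‖ * e + e ^ 2) := by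
  have he : 0 ≤ e := (norm_nonneg _).trans h₁
  have hexp : B d₁ d₂ - h ^ 2 * B a b
      = h * B a (d₂ - h • b) + h * B (d₁ - h • a) b + B (d₁ - h • a) (d₂ - h • b) := by
    simp only [map_sub, map_smul, sub_apply, smul_apply, smul_eq_mul]
    ring
  have b1 : ‖B a (d₂ - h • b)‖ ≤ ‖B‖ * ‖a‖ * e := (B.le_opNorm₂ _ _).trans (by gcongr)
  have b2 : ‖B (d₁ - h • a) b‖ ≤ ‖B‖ * e * ‖b‖ := (B.le_opNorm₂ _ _).trans (by gcongr)
  have b3 : ‖B (d₁ - h • a) (d₂ - h • b)‖ ≤ ‖B‖ * e * e := (B.le_opNorm₂ _ _).trans (by gcongr)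
  rw [hexp, ← Real.norm_eq_abs]
  calc _ ≤ ‖h * B a (d₂ - h • b)‖ + ‖h * B (d₁ - h • a) b‖ + ‖B (d₁ - h • a) (d₂ - h • b)‖ :=
        norm_add₃_le
    _ ≤ h * (‖B‖ * ‖a‖ * e) + h * (‖B‖ * e * ‖b‖) + ‖B‖ * e * e := by
        rw [norm_mul, norm_mul, Real.norm_of_nonneg hh]
        gcongr
    _ = _ := by ring

/-- If the sides of a quadrilateral with vertices `p₀, p₁, p₂, p₃` are close to those of a
parallelogram with sides `h • a`, `h • b`, and the vertical increments along them nearly satisfy the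
contact equation, then `B a b` is small. -/
theorem abs_bilin_le_of_quadrilateral (hB : ∀ x, B x x = 0) {p₀ p₁ p₂ p₃ a b : F} {h e ρ : ℝ}
    (hh : 0 ≤ h)
    (h₀₁ : ‖p₁ - p₀ - h • a‖ ≤ e) (h₁₂ : ‖p₂ - p₁ - h • b‖ ≤ e)
    (h₃₂ : ‖p₂ - p₃ - h • a‖ ≤ e) (h₀₃ : ‖p₃ - p₀ - h • b‖ ≤ e)
    (r₀₁ : |lam (p₁ - p₀) - B p₀ (p₁ - p₀)| ≤ ρ) (r₁₂ : |lam (p₂ - p₁) - B p₁ (p₂ - p₁)| ≤ ρ)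
    (r₃₂ : |lam (p₂ - p₃) - B p₃ (p₂ - p₃)| ≤ ρ) (r₀₃ : |lam (p₃ - p₀) - B p₀ (p₃ - p₀)| ≤ ρ) :
    2 * h ^ 2 * |B a b| ≤ 4 * ρ + 2 * (‖B‖ * (h * ‖a‖ * e + h * ‖b‖ * e + e ^ 2)) := by
  have hskew : ∀ x y, B x y = - B y x := by
    intro x y
    have := hB (x + y)
    simp only [map_add, add_apply, hB] at this
    linarith
  have s1 := abs_bilin_sub_le (B := B) hh h₀₁ h₁₂
  have s2 := abs_bilin_sub_le (B := B) hh h₀₃ h₃₂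
  -- The left side is close to `h² (B a b - B b a) = 2 h² B a b`; the right side is the circulation
  -- of `B` around the loop.
  have hsum : B (p₁ - p₀) (p₂ - p₁) - B (p₃ - p₀) (p₂ - p₃)
      = (B p₀ (p₁ - p₀) + B p₁ (p₂ - p₁) - B p₃ (p₂ - p₃) - B p₀ (p₃ - p₀)) := by
    simp only [map_sub, sub_apply]
    linarith
  have hlam : lam (p₁ - p₀) + lam (p₂ - p₁) - lam (p₂ - p₃) - lam (p₃ - p₀) = 0 := by
    simp only [map_sub]; ring
  rw [hskew b a] at s2
  rw [abs_le] at *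
  have : 2 * h ^ 2 * |B a b| = |2 * h ^ 2 * B a b| := by
    rw [abs_mul, abs_of_nonneg (by positivity : 0 ≤ 2 * h ^ 2)]
  rw [this, abs_le]
  constructor <;> linarith [s1.1, s1.2, s2.1, s2.2]

end Segment

/-! ### Restriction to almost every edge -/

section Edges

variable {E F : Type*} [NormedAddCommGroup E] [NormedSpace ℝ E] [FiniteDimensional ℝ E]
  [MeasurableSpace E] [BorelSpace E] {μ : Measure E} [μ.IsAddHaarMeasure]
  [NormedAddCommGroup F] {f g : E → F} {U W : Set E} {v : E}

theorem integrable_segment_deviation (hgi : Integrable g μ) (hgm : StronglyMeasurable g)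
    (a : F) (c v x₀ : E) (r h : ℝ) :
    Integrable (fun p : E × ℝ => ‖g (p.1 + c + p.2 • v) - a‖)
      ((μ.restrict (Metric.ball x₀ r)).prod (volume.restrict (Ioc 0 h))) := by
  have : IsFiniteMeasure (μ.restrict (Metric.ball x₀ r)) :=
    ⟨by simpa using Metric.isBounded_ball.measure_lt_top⟩
  refine (((integrable_translate_prod hgi hgm c v h).mono_measure ?_).sub
    (integrable_const a)).norm
  exact Measure.prod_mono Measure.restrict_le_self le_rfl

/-- After Fubini, each fixed `t` contributes an integral over a translate of the small ball, which
lies in the large one. -/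
theorem setIntegral_segment_deviation_le (hgi : Integrable g μ) (hgm : StronglyMeasurable g)
    (a : F) (c x₀ : E) {r h R : ℝ} (hh : 0 ≤ h) (hR : r + ‖c‖ + h * ‖v‖ ≤ R) :
    ∫ x in Metric.ball x₀ r, (∫ t in Ioc 0 h, ‖g (x + c + t • v) - a‖) ∂μ
      ≤ h * ∫ x in Metric.closedBall x₀ R, ‖g x - a‖ ∂μ := by
  rw [integral_integral_swap (integrable_segment_deviation hgi hgm a c v x₀ r h)]
  have hint : IntegrableOn (fun x => ‖g x - a‖) (Metric.closedBall x₀ R) μ :=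
    (hgi.integrableOn.sub (integrableOn_const
      (Metric.isBounded_closedBall.measure_lt_top.ne))).norm
  have hbound : ∀ t ∈ Ioc 0 h, ∫ x in Metric.ball x₀ r, ‖g (x + c + t • v) - a‖ ∂μ
      ≤ ∫ x in Metric.closedBall x₀ R, ‖g x - a‖ ∂μ := by
    intro t ht
    have hmp := measurePreserving_add_right μ (c + t • v)
    have hemb := (MeasurableEquiv.addRight (c + t • v)).measurableEmbedding
    have hsub : Metric.ball x₀ r ⊆ (fun x => x + (c + t • v)) ⁻¹' Metric.closedBall x₀ R := by
      intro x hx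
      rw [mem_ball_iff_norm] at hx
      rw [mem_preimage, mem_closedBall_iff_norm]
      have h1 : x + (c + t • v) - x₀ = (x - x₀) + c + t • v := by abel
      have h2 : ‖t • v‖ ≤ h * ‖v‖ := by
        rw [norm_smul, Real.norm_of_nonneg ht.1.le]
        have := ht.2
        gcongr
      rw [h1]
      linarith [norm_add₃_le (a := x - x₀) (b := c) (c := t • v)]
    rw [← hmp.setIntegral_preimage_emb hemb (fun x => ‖g x - a‖)]
    simp only [add_assoc]
    exact setIntegral_mono_set
      ((hmp.integrableOn_comp_preimage hemb).2 hint)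
      (Filter.Eventually.of_forall fun _ => norm_nonneg _) hsub.eventuallyLE
  calc _ ≤ ∫ t in Ioc 0 h, (∫ x in Metric.closedBall x₀ R, ‖g x - a‖ ∂μ) := by
        refine setIntegral_mono_on ?_ (integrable_const _) measurableSet_Ioc hbound
        exact (integrable_segment_deviation hgi hgm a c v x₀ r h).integral_prod_right
    _ = _ := by simp [hh]

variable [NormedSpace ℝ F] {B : F →L[ℝ] F →L[ℝ] ℝ} {lam : F →L[ℝ] ℝ}

/-- The null set in `ae_translate_sub` depends on `t`; joint measurability in `(x, t)` allows the
two quantifiers to be exchanged. -/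
theorem HasWeakDirDeriv.ae_segment [CompleteSpace F] (hw : HasWeakDirDeriv μ U v f g)
    (hfi : Integrable f μ) (hfm : StronglyMeasurable f)
    (hgi : Integrable g μ) (hgm : StronglyMeasurable g) (hW : IsOpen W) {h : ℝ}
    (hWU : ∀ x ∈ W, ∀ s ∈ Icc 0 h, x + s • v ∈ U) :
    ∀ᵐ x ∂μ, ∀ᵐ t ∂(volume.restrict (Ioc 0 h)),
      x ∈ W → f (x + t • v) = f x + ∫ s in (0 : ℝ)..t, g (x + s • v) := by
  have hgm' : StronglyMeasurable (fun p : (E × ℝ) × ℝ => g (p.1.1 + p.2 • v)) :=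
    hgm.comp_measurable (by fun_prop)
  have hI : StronglyMeasurable (fun p : E × ℝ => ∫ s in Ioc 0 p.2, g (p.1 + s • v)) := by
    have : (fun p : E × ℝ => ∫ s in Ioc 0 p.2, g (p.1 + s • v))
        = fun p : E × ℝ => ∫ s, {q : (E × ℝ) × ℝ | q.2 ∈ Ioc 0 q.1.2}.indicator
          (fun q => g (q.1.1 + q.2 • v)) (p, s) := by
      funext p
      rw [← integral_indicator measurableSet_Ioc]
      rfl
    rw [this]
    refine (hgm'.indicator ?_).integral_prod_right'
    exact (measurableSet_lt measurable_const measurable_snd).inter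
      (measurableSet_le measurable_snd (by fun_prop))
  have hmeas : MeasurableSet {p : E × ℝ | p.1 ∈ W →
      f (p.1 + p.2 • v) = f p.1 + ∫ s in Ioc 0 p.2, g (p.1 + s • v)} := by
    refine (hW.measurableSet.preimage measurable_fst).imp ?_
    exact (hfm.comp_measurable (by fun_prop)).measurableSet_eq_fun
      ((hfm.comp_measurable measurable_fst).add hI)
  have hae : ∀ᵐ t ∂(volume.restrict (Ioc 0 h)), ∀ᵐ x ∂μ,
      x ∈ W → f (x + t • v) = f x + ∫ s in Ioc 0 t, g (x + s • v) := by
    refine (ae_restrict_iff' measurableSet_Ioc).2 (Filter.Eventually.of_forall fun t ht => ?_)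
    simp only [← intervalIntegral.integral_of_le ht.1.le]
    exact hw.ae_translate_sub hfi hgi hgm hW ht.1.le
      fun x hx s hs => hWU x hx s ⟨hs.1, hs.2.trans ht.2⟩
  filter_upwards [(Measure.ae_ae_comm hmeas).2 hae] with x hx
  filter_upwards [hx, ae_restrict_mem measurableSet_Ioc] with t ht htm
  rwa [intervalIntegral.integral_of_le htm.1.le]

theorem ae_ae_contact (hfm : StronglyMeasurable f) (hgm : StronglyMeasurable g)
    (hU : MeasurableSet U)
    (hc : ∀ᵐ x ∂μ, x ∈ U → lam (g x) = B (f x) (g x)) (ν : Measure ℝ) [SFinite ν] :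
    ∀ᵐ x ∂μ, ∀ᵐ t ∂ν,
      x + t • v ∈ U → lam (g (x + t • v)) = B (f (x + t • v)) (g (x + t • v)) := by
  have hm : MeasurableSet {x | x ∈ U → lam (g x) = B (f x) (g x)} :=
    hU.imp ((lam.continuous.comp_stronglyMeasurable hgm).measurableSet_eq_fun
      (B.isBoundedBilinearMap.continuous.comp_stronglyMeasurable (hfm.prodMk hgm)))
  refine (Measure.ae_ae_comm (p := fun x t =>
      x + t • v ∈ U → lam (g (x + t • v)) = B (f (x + t • v)) (g (x + t • v)))
    (hm.preimage (f := fun p : E × ℝ => p.1 + p.2 • v) (by fun_prop))).2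
      (Filter.Eventually.of_forall fun t => ?_)
  exact (quasiMeasurePreserving_add_right μ (t • v)).ae hc

/-- For almost every base point, the restriction of a weakly contact map to the segment
`[x, x + h • v]` satisfies the conclusions of the one-dimensional estimates. -/
theorem HasWeakDirDeriv.ae_contact_segment_le [CompleteSpace F] (hw : HasWeakDirDeriv μ U v f g)
    (hB : ∀ x, B x x = 0)
    (hfi : Integrable f μ) (hfm : StronglyMeasurable f)
    (hgi : Integrable g μ) (hgm : StronglyMeasurable g) (hU : MeasurableSet U)
    (hc : ∀ᵐ x ∂μ, x ∈ U → lam (g x) = B (f x) (g x)) (hW : IsOpen W) {h : ℝ} (hh : 0 ≤ h)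
    (hWU : ∀ x ∈ W, ∀ s ∈ Icc 0 h, x + s • v ∈ U) (a : F) :
    ∀ᵐ x ∂μ, x ∈ W → ∀ e, (∫ t in Ioc 0 h, ‖g (x + t • v) - a‖) ≤ e →
      ‖f (x + h • v) - f x - h • a‖ ≤ e ∧
      |lam (f (x + h • v) - f x) - B (f x) (f (x + h • v) - f x)|
        ≤ ‖B‖ * (2 * h * ‖a‖ * e + e ^ 2) := by
  -- The endpoint `t = h` could be missed by a statement for almost every `t`, so its identity is
  -- supplied separately.
  filter_upwards [hw.ae_segment hfi hfm hgi hgm hW hWU,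
    hw.ae_translate_sub hfi hgi hgm hW hh hWU, ae_intervalIntegrable_translate hgi hgm hh,
    ae_ae_contact (v := v) hfm hgm hU hc (volume.restrict (Ioc 0 h))] with x h1 h2 h3 h4 hxW e he
  have hinc : f (x + h • v) - f x = ∫ s in (0 : ℝ)..h, g (x + s • v) := by
    rw [h2 hxW, add_sub_cancel_left]
  rw [← intervalIntegral.integral_of_le hh] at he
  have he0 : 0 ≤ ∫ t in (0 : ℝ)..h, ‖g (x + t • v) - a‖ :=
    intervalIntegral.integral_nonneg hh fun _ _ => norm_nonneg _
  rw [hinc]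
  refine ⟨(norm_integral_sub_smul_le hh h3 a).trans he, ?_⟩
  refine (abs_contact_segment_le hh hB h3 (f x) a ?_).trans (by gcongr)
  filter_upwards [h1, h4, ae_restrict_mem measurableSet_Ioc] with t ht1 ht4 htm
  rw [← ht1 hxW]
  exact ht4 (hWU x hxW t ⟨htm.1.le, htm.2⟩)

end Edges

/-! ### Lebesgue points and the choice of a parallelogram -/

section Local

variable {E F : Type*} [NormedAddCommGroup E] [NormedSpace ℝ E] [FiniteDimensional ℝ E]
  [MeasurableSpace E] [BorelSpace E] {μ : Measure E} [μ.IsAddHaarMeasure]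
  [NormedAddCommGroup F]

theorem ae_tendsto_average_closedBall {g : E → F} (hg : Integrable g μ) :
    ∀ᵐ x ∂μ, Filter.Tendsto
      (fun r : ℝ => ⨍ y in Metric.closedBall x r, ‖g y - g x‖ ∂μ) (nhdsWithin 0 (Ioi 0))
      (nhds 0) := by
  filter_upwards [IsUnifLocDoublingMeasure.ae_tendsto_average_norm_sub μ hg.locallyIntegrable 1]
    with x hx
  refine hx (fun _ => x) (fun r => r) Filter.tendsto_id ?_
  filter_upwards [self_mem_nhdsWithin] with r hr
  simpa using (mem_Ioi.1 hr).le

/-- The power of `K` is the volume ratio of the two balls, so the bound scales like `h` uniformly.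
-/
theorem setAverage_segment_deviation_le {g : E → F} (hgi : Integrable g μ)
    (hgm : StronglyMeasurable g) (a : F) (c v x₀ : E) {h K : ℝ} (hh : 0 < h)
    (hK : h + ‖c‖ + h * ‖v‖ ≤ K * h) :
    ⨍ x in Metric.ball x₀ h, (∫ t in Ioc 0 h, ‖g (x + c + t • v) - a‖) ∂μ
      ≤ h * (K ^ Module.finrank ℝ E *
        ⨍ x in Metric.closedBall x₀ (K * h), ‖g x - a‖ ∂μ) := by
  have hKpos : 0 < K := by
    have : 0 < K * h := by
      have : 0 ≤ h * ‖v‖ := by positivity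
      linarith [norm_nonneg c]
    exact pos_of_mul_pos_left this hh.le
  have hb : 0 < μ.real (Metric.ball x₀ h) :=
    ENNReal.toReal_pos (Metric.measure_ball_pos μ x₀ hh).ne' Metric.isBounded_ball.measure_lt_top.ne
  have hcb : μ.real (Metric.closedBall x₀ (K * h))
      = K ^ Module.finrank ℝ E * μ.real (Metric.ball x₀ h) := by
    rw [Measure.addHaar_real_closedBall μ x₀ (by positivity), measureReal_def μ (Metric.ball x₀ h),
      Measure.addHaar_ball_of_pos μ x₀ hh, ENNReal.toReal_mul, ENNReal.toReal_ofReal (by positivity),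
      mul_pow, measureReal_def]
    ring
  have hKne : K ^ Module.finrank ℝ E ≠ 0 := (pow_pos hKpos _).ne'
  rw [setAverage_eq, setAverage_eq, hcb, smul_eq_mul, smul_eq_mul]
  refine (mul_le_mul_of_nonneg_left
    (setIntegral_segment_deviation_le hgi hgm a c x₀ hh.le hK) (by positivity)).trans (le_of_eq ?_)
  field_simp

variable [NormedSpace ℝ F] [CompleteSpace F] {B : F →L[ℝ] F →L[ℝ] ℝ} {lam : F →L[ℝ] ℝ} {U : Set E}
  {f gv gw : E → F} {v w : E}

theorem abs_bilin_le_of_average_le (hU : IsOpen U) (hB : ∀ x, B x x = 0)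
    (hfi : Integrable f μ) (hfm : StronglyMeasurable f)
    (hvi : Integrable gv μ) (hvm : StronglyMeasurable gv)
    (hwi : Integrable gw μ) (hwm : StronglyMeasurable gw)
    (hv : HasWeakDirDeriv μ U v f gv) (hw : HasWeakDirDeriv μ U w f gw)
    (hcv : ∀ᵐ x ∂μ, x ∈ U → lam (gv x) = B (f x) (gv x))
    (hcw : ∀ᵐ x ∂μ, x ∈ U → lam (gw x) = B (f x) (gw x))
    (a b : F) (x₀ : E) {h K η : ℝ} (hh : 0 < h) (hK : K = 1 + ‖v‖ + ‖w‖)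
    (hKU : Metric.closedBall x₀ (K * h) ⊆ U)
    (hηv : K ^ Module.finrank ℝ E * (⨍ x in Metric.closedBall x₀ (K * h), ‖gv x - a‖ ∂μ) ≤ η / 4)
    (hηw : K ^ Module.finrank ℝ E * (⨍ x in Metric.closedBall x₀ (K * h), ‖gw x - b‖ ∂μ) ≤ η / 4) :
    |B a b| ≤ ‖B‖ * (5 * (‖a‖ + ‖b‖) * η + 3 * η ^ 2) := by
  let Φ (g : E → F) (a' : F) (c u : E) (x : E) : ℝ := ∫ t in Ioc 0 h, ‖g (x + c + t • u) - a'‖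
  have hΦ0 : ∀ g a' c u x, 0 ≤ Φ g a' c u x := fun g a' c u x =>
    integral_nonneg fun _ => norm_nonneg _
  have hΦi : ∀ {g : E → F}, Integrable g μ → StronglyMeasurable g → ∀ a' c u,
      Integrable (Φ g a' c u) (μ.restrict (Metric.ball x₀ h)) := fun hgi hgm a' c u =>
    (integrable_segment_deviation hgi hgm a' c u x₀ h h).integral_prod_left
  -- the four sides of the parallelogram
  have hnv : ‖h • v‖ = h * ‖v‖ := by rw [norm_smul, Real.norm_of_nonneg hh.le]
  have hnw : ‖h • w‖ = h * ‖w‖ := by rw [norm_smul, Real.norm_of_nonneg hh.le]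
  have hpv : 0 ≤ h * ‖v‖ := by positivity
  have hpw : 0 ≤ h * ‖w‖ := by positivity
  -- With `K = 1 + ‖v‖ + ‖w‖`, all four edges stay in `closedBall x₀ (K * h)` for every base point
  -- in the ball of radius `h`.
  have kv0 : h + ‖(0 : E)‖ + h * ‖v‖ ≤ K * h := by rw [norm_zero, hK]; linarith
  have kvw : h + ‖h • w‖ + h * ‖v‖ ≤ K * h := by rw [hnw, hK]; linarith
  have kw0 : h + ‖(0 : E)‖ + h * ‖w‖ ≤ K * h := by rw [norm_zero, hK]; linarith
  have kwv : h + ‖h • v‖ + h * ‖w‖ ≤ K * h := by rw [hnv, hK]; linarith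
  have hedge : ∀ {g : E → F} {u : E}, Integrable g μ → StronglyMeasurable g →
      HasWeakDirDeriv μ U u f g → (∀ᵐ x ∂μ, x ∈ U → lam (g x) = B (f x) (g x)) →
      ∀ (a' : F) (c : E), h + ‖c‖ + h * ‖u‖ ≤ K * h →
      ∀ᵐ x ∂μ, x ∈ Metric.ball x₀ h → ∀ e, Φ g a' c u x ≤ e →
        ‖f (x + c + h • u) - f (x + c) - h • a'‖ ≤ e ∧
        |lam (f (x + c + h • u) - f (x + c)) - B (f (x + c)) (f (x + c + h • u) - f (x + c))|
          ≤ ‖B‖ * (2 * h * ‖a'‖ * e + e ^ 2) := by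
    intro g u hgi hgm hg hgc a' c hc
    have hW : ∀ y ∈ Metric.ball (x₀ + c) h, ∀ s ∈ Icc 0 h, y + s • u ∈ U := by
      intro y hy s hs
      refine hKU ?_
      rw [mem_ball_iff_norm] at hy
      rw [mem_closedBall_iff_norm]
      have h1 : y + s • u - x₀ = (y - (x₀ + c)) + c + s • u := by abel
      have h2 : ‖s • u‖ ≤ h * ‖u‖ := by
        rw [norm_smul, Real.norm_of_nonneg hs.1]
        have := hs.2
        gcongr
      rw [h1]
      linarith [norm_add₃_le (a := y - (x₀ + c)) (b := c) (c := s • u)]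
    have := hg.ae_contact_segment_le hB hfi hfm hgi hgm hU.measurableSet hgc Metric.isOpen_ball
      hh.le hW a'
    filter_upwards [(quasiMeasurePreserving_add_right μ c).ae this] with x hx hxb
    exact hx (by simpa [mem_ball_iff_norm] using hxb)
  have E1 := hedge hvi hvm hv hcv a 0 kv0
  have E2 := hedge hwi hwm hw hcw b (h • v) kwv
  have E3 := hedge hvi hvm hv hcv a (h • w) kvw
  have E4 := hedge hwi hwm hw hcw b 0 kw0
  -- averaging over the base point
  have i1 := hΦi hvi hvm a 0 v
  have i2 := hΦi hwi hwm b (h • v) w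
  have i3 := hΦi hvi hvm a (h • w) v
  have i4 := hΦi hwi hwm b 0 w
  have hball0 : μ.restrict (Metric.ball x₀ h) ≠ 0 := by
    rw [Ne, Measure.restrict_eq_zero]
    exact (Metric.measure_ball_pos μ x₀ hh).ne'
  have : IsFiniteMeasure (μ.restrict (Metric.ball x₀ h)) :=
    ⟨by simpa using Metric.isBounded_ball.measure_lt_top⟩
  have hgood : ∀ᵐ x ∂(μ.restrict (Metric.ball x₀ h)), _ :=
    ((ae_restrict_mem Metric.isOpen_ball.measurableSet).and
      ((ae_restrict_of_ae E1).and ((ae_restrict_of_ae E2).and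
        ((ae_restrict_of_ae E3).and (ae_restrict_of_ae E4)))))
  -- One base point serves all four edges: the summed deviation is at most its average, and the
  -- exceptional null set is avoided.
  obtain ⟨x, hxN, hx⟩ := exists_notMem_null_le_average hball0 (((i1.add i2).add i3).add i4)
    (ae_iff.1 hgood)
  simp only [mem_ofPred_eq, not_not] at hxN
  obtain ⟨hxb, F1, F2, F3, F4⟩ := hxN
  have m1 := setAverage_segment_deviation_le hvi hvm a 0 v x₀ hh kv0
  have m2 := setAverage_segment_deviation_le hwi hwm b (h • v) w x₀ hh kwv
  have m3 := setAverage_segment_deviation_le hvi hvm a (h • w) v x₀ hh kvw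
  have m4 := setAverage_segment_deviation_le hwi hwm b 0 w x₀ hh kw0
  have hsum : Φ gv a 0 v x + Φ gw b (h • v) w x + Φ gv a (h • w) v x + Φ gw b 0 w x ≤ h * η := by
    refine hx.trans ?_
    rw [average_eq, integral_add' ((i1.add i2).add i3) i4, integral_add' (i1.add i2) i3,
      integral_add' i1 i2, smul_add, smul_add, smul_add, ← average_eq, ← average_eq, ← average_eq,
      ← average_eq]
    have hv' := mul_le_mul_of_nonneg_left hηv hh.le
    have hw' := mul_le_mul_of_nonneg_left hηw hh.le
    linarith
  have p1 := hΦ0 gv a 0 v x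
  have p2 := hΦ0 gw b (h • v) w x
  have p3 := hΦ0 gv a (h • w) v x
  have p4 := hΦ0 gw b 0 w x
  have G1 := F1 hxb (h * η) (by linarith)
  have G2 := F2 hxb (h * η) (by linarith)
  have G3 := F3 hxb (h * η) (by linarith)
  have G4 := F4 hxb (h * η) (by linarith)
  have hη : 0 ≤ η := by
    have : 0 ≤ h * η := by linarith
    exact nonneg_of_mul_nonneg_right this hh
  simp only [add_zero] at G1 G4
  -- Both paths must end at the same vertex `x + h • v + h • w`.
  rw [add_right_comm] at G3
  have ha : ‖B‖ * (2 * h * ‖a‖ * (h * η) + (h * η) ^ 2)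
      ≤ ‖B‖ * (2 * h * (‖a‖ + ‖b‖) * (h * η) + (h * η) ^ 2) := by
    gcongr; linarith [norm_nonneg b]
  have hb : ‖B‖ * (2 * h * ‖b‖ * (h * η) + (h * η) ^ 2)
      ≤ ‖B‖ * (2 * h * (‖a‖ + ‖b‖) * (h * η) + (h * η) ^ 2) := by
    gcongr; linarith [norm_nonneg a]
  have key := abs_bilin_le_of_quadrilateral hB hh.le G1.1 G2.1 G3.1 G4.1 (G1.2.trans ha)
    (G2.2.trans hb) (G3.2.trans ha) (G4.2.trans hb)
  have hh2 : 0 < 2 * h ^ 2 := by positivity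
  refine le_of_mul_le_mul_left (key.trans (le_of_eq ?_)) hh2
  ring

/-- A map satisfying the contact equation `lam (df) = B f df` weakly, for an alternating form `B`,
has isotropic differential almost everywhere. -/
theorem ae_bilin_weakDirDeriv_eq_zero (hU : IsOpen U) (hB : ∀ x, B x x = 0)
    (hfi : Integrable f μ) (hfm : StronglyMeasurable f)
    (hvi : Integrable gv μ) (hvm : StronglyMeasurable gv)
    (hwi : Integrable gw μ) (hwm : StronglyMeasurable gw)
    (hv : HasWeakDirDeriv μ U v f gv) (hw : HasWeakDirDeriv μ U w f gw)
    (hcv : ∀ᵐ x ∂μ, x ∈ U → lam (gv x) = B (f x) (gv x))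
    (hcw : ∀ᵐ x ∂μ, x ∈ U → lam (gw x) = B (f x) (gw x)) :
    ∀ᵐ x ∂μ, x ∈ U → B (gv x) (gw x) = 0 := by
  filter_upwards [ae_tendsto_average_closedBall hvi, ae_tendsto_average_closedBall hwi]
    with x₀ hxv hxw hx₀
  obtain ⟨K, hK⟩ : ∃ K : ℝ, K = 1 + ‖v‖ + ‖w‖ := ⟨_, rfl⟩
  have hKpos : 0 < K := by rw [hK]; positivity
  have hbound : ∀ η > 0,
      |B (gv x₀) (gw x₀)| ≤ ‖B‖ * (5 * (‖gv x₀‖ + ‖gw x₀‖) * η + 3 * η ^ 2) := by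
    intro η hη
    have hη' : 0 < η / 4 / K ^ Module.finrank ℝ E := by positivity
    obtain ⟨ρ, hρ, hρU⟩ := Metric.isOpen_iff.1 hU x₀ hx₀
    obtain ⟨r, ⟨⟨h1, h2⟩, h3⟩, hr⟩ := (((hxv.eventually_lt_const hη').and
      (hxw.eventually_lt_const hη')).and
        (mem_nhdsWithin_of_mem_nhds (Iio_mem_nhds hρ))).and self_mem_nhdsWithin |>.exists
    have hr0 : 0 < r := hr
    have hrK : K * (r / K) = r := by field_simp
    rw [lt_div_iff₀' (by positivity)] at h1 h2
    refine abs_bilin_le_of_average_le (h := r / K) hU hB hfi hfm hvi hvm hwi hwm hv hw hcv hcw _ _ x₀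
      (by positivity) hK ?_ (by rw [hrK]; exact h1.le) (by rw [hrK]; exact h2.le)
    rw [hrK]
    exact (Metric.closedBall_subset_ball h3).trans hρU
  have hlim : Filter.Tendsto
      (fun η : ℝ => ‖B‖ * (5 * (‖gv x₀‖ + ‖gw x₀‖) * η + 3 * η ^ 2)) (nhdsWithin 0 (Ioi 0))
      (nhds 0) := by
    have : Continuous (fun η : ℝ => ‖B‖ * (5 * (‖gv x₀‖ + ‖gw x₀‖) * η + 3 * η ^ 2)) := by
      fun_prop
    simpa using (this.tendsto 0).mono_left nhdsWithin_le_nhds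
  have hle := ge_of_tendsto hlim (Filter.eventually_of_mem self_mem_nhdsWithin hbound)
  exact abs_nonpos_iff.1 hle

end Local

/-! ### Localisation and the contact form -/

section Contact

/-- Test functions supported in `U ⊆ S` do not see the truncation to `S`, which makes globally
integrable representatives possible. -/
theorem IsWeakFDeriv.hasWeakDirDeriv {m : ℕ} {F : Type*} [NormedAddCommGroup F] [NormedSpace ℝ F]
    {Ω U S : Set (EuclideanSpace ℝ (Fin m))} {f f₀ g₀ : EuclideanSpace ℝ (Fin m) → F}
    {f' : EuclideanSpace ℝ (Fin m) → EuclideanSpace ℝ (Fin m) →L[ℝ] F}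
    (h : IsWeakFDeriv Ω f f') (hΩ : MeasurableSet Ω) (hUS : U ⊆ S) (hSΩ : S ⊆ Ω)
    (v : EuclideanSpace ℝ (Fin m))
    (hf₀ : f₀ =ᵐ[volume] S.indicator f) (hg₀ : g₀ =ᵐ[volume] S.indicator fun x => f' x v) :
    HasWeakDirDeriv volume U v f₀ g₀ := by
  intro φ hφ hφc hφU
  have haux : ∀ (ψ : EuclideanSpace ℝ (Fin m) → ℝ) (u u₀ : EuclideanSpace ℝ (Fin m) → F),
      (∀ x, x ∉ tsupport φ → ψ x = 0) → u₀ =ᵐ[volume] S.indicator u →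
      ∫ x, ψ x • u₀ x = ∫ x in Ω, ψ x • u x := by
    intro ψ u u₀ hψ hu
    rw [← integral_indicator hΩ]
    refine integral_congr_ae ?_
    filter_upwards [hu] with x hx
    by_cases hxφ : x ∈ tsupport φ
    · have hxS := hUS (hφU hxφ)
      rw [hx, indicator_of_mem hxS, indicator_of_mem (hSΩ hxS)]
    · simp [indicator, hψ x hxφ]
  rw [haux _ f f₀ (fun x hx => ?_) hf₀,
    haux φ _ g₀ (fun x hx => image_eq_zero_of_notMem_tsupport hx) hg₀]
  · exact h.integral_eq φ hφ hφc (hφU.trans (hUS.trans hSΩ)) v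
  · have : fderiv ℝ φ x = 0 := by
      by_contra hne
      exact hx (support_fderiv_subset ℝ hne)
    simp [this]

/-- The form `(p, q) ↦ ∑ⱼ (pʲ q^{j+n} - p^{j+n} qʲ)` on `ℝ^{2n+1}`. -/
noncomputable def contactForm (n : ℕ) :
    EuclideanSpace ℝ (Fin (2 * n + 1)) →L[ℝ] EuclideanSpace ℝ (Fin (2 * n + 1)) →L[ℝ] ℝ :=
  ∑ j : Fin n,
    ((EuclideanSpace.proj (𝕜 := ℝ) (idxFst j)).smulRight
        (EuclideanSpace.proj (𝕜 := ℝ) (idxSnd j)) -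
      (EuclideanSpace.proj (𝕜 := ℝ) (idxSnd j)).smulRight
        (EuclideanSpace.proj (𝕜 := ℝ) (idxFst j)))

theorem contactForm_apply {n : ℕ} (p q : EuclideanSpace ℝ (Fin (2 * n + 1))) :
    contactForm n p q = ∑ j : Fin n, (p (idxFst j) * q (idxSnd j) - p (idxSnd j) * q (idxFst j)) := by
  simp [contactForm]

theorem contactForm_self {n : ℕ} (p : EuclideanSpace ℝ (Fin (2 * n + 1))) :
    contactForm n p p = 0 := by
  rw [contactForm_apply]
  exact Finset.sum_eq_zero fun j _ => by ring

theorem ContactEq.proj_last_apply {m n : ℕ} {p : EuclideanSpace ℝ (Fin (2 * n + 1))}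
    {A : EuclideanSpace ℝ (Fin m) →L[ℝ] EuclideanSpace ℝ (Fin (2 * n + 1))} (h : ContactEq p A)
    (v : EuclideanSpace ℝ (Fin m)) :
    EuclideanSpace.proj (𝕜 := ℝ) (idxLast n) (A v) = contactForm n p (A v) := by
  have := congrArg (fun L => L v) h
  simpa [diffComp, contactForm_apply, sum_apply] using this

theorem sum_covectorWedge_apply {m n : ℕ}
    (A : EuclideanSpace ℝ (Fin m) →L[ℝ] EuclideanSpace ℝ (Fin (2 * n + 1)))
    (u : Fin 2 → EuclideanSpace ℝ (Fin m)) :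
    (∑ j : Fin n, covectorWedge (diffComp A (idxFst j)) (diffComp A (idxSnd j))) u
      = contactForm n (A (u 0)) (A (u 1)) := by
  rw [contactForm_apply, ContinuousAlternatingMap.sum_apply]
  refine Finset.sum_congr rfl fun j _ => ?_
  rw [covectorWedge_apply]
  simp [diffComp]
  ring

/-- Checking basis pairs suffices by bilinearity, so only finitely many null sets have to be
discarded. -/
theorem sum_covectorWedge_eq_zero {m n : ℕ}
    (A : EuclideanSpace ℝ (Fin m) →L[ℝ] EuclideanSpace ℝ (Fin (2 * n + 1)))
    (h : ∀ i k : Fin m, contactForm n (A (EuclideanSpace.single i 1))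
      (A (EuclideanSpace.single k 1)) = 0) :
    ∑ j : Fin n, covectorWedge (diffComp A (idxFst j)) (diffComp A (idxSnd j)) = 0 := by
  have hexp : ∀ v : EuclideanSpace ℝ (Fin m),
      A v = ∑ i, v i • A (EuclideanSpace.single i 1) := by
    intro v
    conv_lhs => rw [← (EuclideanSpace.basisFun (Fin m) ℝ).sum_repr v]
    simp
  ext u
  rw [sum_covectorWedge_apply, hexp (u 0), hexp (u 1)]
  simp [h]

theorem ae_contactForm_weakFDeriv_eq_zero {m n : ℕ}
    {Ω : Set (EuclideanSpace ℝ (Fin m))} (hΩ : IsOpen Ω)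
    {f : EuclideanSpace ℝ (Fin m) → EuclideanSpace ℝ (Fin (2 * n + 1))}
    (hf : LocallyIntegrableOn f Ω volume)
    {Df : EuclideanSpace ℝ (Fin m) →
      EuclideanSpace ℝ (Fin m) →L[ℝ] EuclideanSpace ℝ (Fin (2 * n + 1))}
    (hDf : IsWeakFDeriv Ω f Df)
    (hcontact : ∀ᵐ x ∂(volume.restrict Ω), ContactEq (f x) (Df x))
    (v w : EuclideanSpace ℝ (Fin m)) :
    ∀ᵐ x, x ∈ Ω → contactForm n (Df x v) (Df x w) = 0 := by
  rw [ae_iff]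
  -- Local integrability gives integrability only on compact sets, hence the reduction to a closed
  -- ball inside `Ω`.
  refine measure_null_of_locally_null _ fun x₀ hx₀ => ?_
  simp only [mem_ofPred_eq, Classical.not_imp] at hx₀
  obtain ⟨R, hR, hRΩ⟩ := Metric.nhds_basis_closedBall.mem_iff.1 (hΩ.mem_nhds hx₀.1)
  set S := Metric.closedBall x₀ R
  refine ⟨_ ∩ Metric.ball x₀ R, Filter.inter_mem self_mem_nhdsWithin
    (mem_nhdsWithin_of_mem_nhds (Metric.ball_mem_nhds x₀ hR)), ?_⟩
  have hSm : MeasurableSet S := Metric.isClosed_closedBall.measurableSet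
  have hScpt : IsCompact S := isCompact_closedBall x₀ R
  have hUS : Metric.ball x₀ R ⊆ S := Metric.ball_subset_closedBall
  have hfi : Integrable (S.indicator f) :=
    (hf.integrableOn_compact_subset hRΩ hScpt).integrable_indicator hSm
  have hDi : ∀ u, Integrable (S.indicator fun x => Df x u) := fun u =>
    IntegrableOn.integrable_indicator
      ((hDf.locallyIntegrableOn.integrableOn_compact_subset hRΩ hScpt).apply_continuousLinearMap u)
      hSm
  have hc : ∀ u, ∀ᵐ x, x ∈ Metric.ball x₀ R →
      EuclideanSpace.proj (𝕜 := ℝ) (idxLast n) ((hDi u).1.mk _ x)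
        = contactForm n (hfi.1.mk _ x) ((hDi u).1.mk _ x) := by
    intro u
    filter_upwards [(ae_restrict_iff' hΩ.measurableSet).1 hcontact, hfi.1.ae_eq_mk,
      (hDi u).1.ae_eq_mk] with x h1 h2 h3 hx
    rw [← h2, ← h3, indicator_of_mem (hUS hx), indicator_of_mem (hUS hx)]
    exact (h1 (hRΩ (hUS hx))).proj_last_apply u
  have hweak : ∀ u, HasWeakDirDeriv volume (Metric.ball x₀ R) u (hfi.1.mk _) ((hDi u).1.mk _) :=
    fun u => hDf.hasWeakDirDeriv hΩ.measurableSet hUS hRΩ u hfi.1.ae_eq_mk.symm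
      (hDi u).1.ae_eq_mk.symm
  have key := ae_bilin_weakDirDeriv_eq_zero Metric.isOpen_ball contactForm_self
    (hfi.congr hfi.1.ae_eq_mk) hfi.1.stronglyMeasurable_mk
    ((hDi v).congr (hDi v).1.ae_eq_mk) (hDi v).1.stronglyMeasurable_mk
    ((hDi w).congr (hDi w).1.ae_eq_mk) (hDi w).1.stronglyMeasurable_mk
    (hweak v) (hweak w) (hc v) (hc w)
  have key' : ∀ᵐ x, x ∈ Metric.ball x₀ R → contactForm n (Df x v) (Df x w) = 0 := by
    filter_upwards [key, (hDi v).1.ae_eq_mk, (hDi w).1.ae_eq_mk] with x h1 h2 h3 hx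
    have := h1 hx
    rwa [← h2, ← h3, indicator_of_mem (hUS hx), indicator_of_mem (hUS hx)] at this
  refine measure_mono_null ?_ (ae_iff.1 key')
  rintro x ⟨hx1, hx2⟩ hx3
  exact hx1 fun _ => hx3 hx2

end Contact

theorem mainTheorem4 {m n : ℕ} (hm : 2 ≤ m)
    {Ω : Set (EuclideanSpace ℝ (Fin m))} (hΩ : IsOpen Ω)
    (f : EuclideanSpace ℝ (Fin m) → EuclideanSpace ℝ (Fin (2 * n + 1)))
    (hf : MemW11Loc Ω f)
    (Df : EuclideanSpace ℝ (Fin m) →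
      EuclideanSpace ℝ (Fin m) →L[ℝ] EuclideanSpace ℝ (Fin (2 * n + 1)))
    (hDf : IsWeakFDeriv Ω f Df)
    (hcontact : ∀ᵐ x ∂(volume.restrict Ω), ContactEq (f x) (Df x)) :
    ∀ᵐ x ∂(volume.restrict Ω),
      ∑ j : Fin n,
        covectorWedge (diffComp (Df x) (idxFst j)) (diffComp (Df x) (idxSnd j)) = 0 := by
  have hae : ∀ᵐ x, ∀ i k : Fin m, x ∈ Ω → contactForm n (Df x (EuclideanSpace.single i 1))
      (Df x (EuclideanSpace.single k 1)) = 0 :=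
    ae_all_iff.2 fun i => ae_all_iff.2 fun k =>
      ae_contactForm_weakFDeriv_eq_zero hΩ hf.1 hDf hcontact _ _
  refine (ae_restrict_iff' hΩ.measurableSet).2 ?_
  filter_upwards [hae] with x hx hxΩ
  exact sum_covectorWedge_eq_zero (Df x) fun i k => hx i k hxΩ
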